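/- All rows and columns are indexed from $0$, and $[s]=\{0,1,\dots,s-1\}$. For positive integers $m,n$, an $m\times n$ \emph{Ferrers diagram} is an $m\times n$ array of dots and empty cells in which all dots are shifted to the right, no row has more dots than the row above it, the first row has $n$ dots and the rightmost column has $m$ dots; it is identified with the set of its dots $(i,j)\in[m]\times[n]$ (row $i$, column $j$). Let $\rho_i(\cdot)$ and $\gamma_j(\cdot)$ denote the numbers of dots in row $i$ and in column $j$ of a diagram. For an $m\times n$ Ferrers diagram $\mathcal F$ and a prime power $q$, an $[\mathcal F,k,\delta]_q$ code is a $k$-dimensional $\mathbb F_q$-linear subspace $\mathcal C$ of $\mathbb F_q^{m\times n}$, all of whose matrices vanish outside $\mathcal F$, with minimum rank distance $\min\{\operatorname{rank}(A-B): A,B\in\mathcal C,\ A\ne B\}=\delta$. It is \emph{optimal} if $k=\min_{i\in[\delta]}v_i$, where $v_i$ is the number of dots of $\mathcal F$ lying neither in the first $i$ rows nor in the rightmost $\delta-1-i$ columns. \textbf{Theorem.} Let $m_1,n_1,m_3,n_3$ be positive integers, let $\mathcal F_1$ be an $m_1\times n_1$ Ferrers diagram and $\mathcal F_3$ an $m_3\times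 n_3$ Ferrers diagram. Let $\mathcal F$ be the $(m_1+m_3)\times(n_1+n_3)$ Ferrers diagram with upper left $m_1\times n_1$ block $\mathcal F_1$, upper right $m_1\times n_3$ block full, lower right $m_3\times n_3$ block $\mathcal F_3$, and lower left $m_3\times n_1$ block having the single dot $(m_1,n_1-1)$. Write $\rho_i=\rho_i(\mathcal F)$, and let $\alpha_0\le\alpha_1\le\dots\le\alpha_{m_1+n_3}$ be the $m_1+n_3+1$ numbers $1$, $\rho_i(\mathcal F_1)$ $(i\in[m_1])$, $\gamma_j(\mathcal F_3)$ $(j\in[n_3])$, listed with multiplicity and sorted. Let $\delta$ be an integer with $2\le\delta\le m_1+1$, and suppose that 1. if $\delta<m_1+1$, then $n_3\ge m_1$; 2. $1+m_1+n_3\le\max\{n_1,m_3\}$; 3. $\alpha_{m_1+n_3-\delta+2}\ge m_1+n_3$; 4. $\rho_{\delta-2}-n_3\ge m_3$. Then for every prime power $q$ there exists an optimal $\left[\mathcal F,\ \sum_{i=\delta-1}^{m_1+m_3-1}\rho_i,\ \delta\right]_q$ code. -/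

import Mathlib

open scoped BigOperators

/-- `F` is an `m × n` Ferrers diagram. A cell is a pair `(i, j)` (row `i`, column `j`, both counted
from `0`), and `F` is the set of the cells that hold a dot. All dots are shifted to the top and to
the right, the first row has `n` dots and the rightmost column has `m` dots. -/
structure IsFerrersDiagram (m n : ℕ) (F : Finset (ℕ × ℕ)) : Prop where
  rows_pos : 0 < m
  cols_pos : 0 < n
  subset : ∀ i j, (i, j) ∈ F → i < m ∧ j < n
  up : ∀ i j, (i + 1, j) ∈ F → (i, j) ∈ F
  right : ∀ i j, (i, j) ∈ F → j + 1 < n → (i, j + 1) ∈ F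
  first_row : ∀ j, j < n → (0, j) ∈ F
  last_col : ∀ i, i < m → (i, n - 1) ∈ F

/-- The number of dots in row `i`. -/
def rowDots (F : Finset (ℕ × ℕ)) (i : ℕ) : ℕ := (F.filter fun p => p.1 = i).card

/-- The number of dots in column `j`. -/
def colDots (F : Finset (ℕ × ℕ)) (j : ℕ) : ℕ := (F.filter fun p => p.2 = j).card

/-- The full `m × n` Ferrers diagram, with `m n` dots. -/
def fullDiagram (m n : ℕ) : Finset (ℕ × ℕ) := Finset.range m ×ˢ Finset.range n

/-- The diagram `F` moved `a` rows down and `b` columns to the right. -/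
def shiftDiagram (a b : ℕ) (F : Finset (ℕ × ℕ)) : Finset (ℕ × ℕ) :=
  F.image fun p => (p.1 + a, p.2 + b)

/-- The array of size `(m₁ + m₃) × (n₁ + n₃)` with `F₁` (of size `m₁ × n₁`) in the upper left block,
the full `m₁ × n₃` diagram in the upper right block, `F₃` (of size `m₃ × n₃`) in the lower right
block, and the single dot `(m₁, n₁ - 1)` in the upper right corner of the lower left block. -/
def oneDotArray (m₁ n₁ n₃ : ℕ) (F₁ F₃ : Finset (ℕ × ℕ)) : Finset (ℕ × ℕ) :=
  F₁ ∪ {(m₁, n₁ - 1)} ∪ shiftDiagram m₁ n₁ F₃ ∪ shiftDiagram 0 n₁ (fullDiagram m₁ n₃)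

/-- The list `1`, `ρ_i(F₁)` for `i < m₁`, `γ_j(F₃)` for `j < n₃` (with repetitions), sorted from
small to large. It has `m₁ + n₃ + 1` entries. -/
def sortedDots (m₁ n₃ : ℕ) (F₁ F₃ : Finset (ℕ × ℕ)) : List ℕ :=
  ({1} + (Multiset.range m₁).map (rowDots F₁) + (Multiset.range n₃).map (colDots F₃)).sort (· ≤ ·)

/-- The entry `α_l` of the sorted list, `0 ≤ l ≤ m₁ + n₃` (a meaningless `0` for larger `l`). -/
def sortedDot (m₁ n₃ : ℕ) (F₁ F₃ : Finset (ℕ × ℕ)) (l : ℕ) : ℕ :=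
  (sortedDots m₁ n₃ F₁ F₃).getD l 0

/-- The number of dots of `F` (a diagram with `n` columns) that lie neither in the first `i` rows
nor in the rightmost `δ - 1 - i` columns; used for `0 ≤ i ≤ δ - 1`. -/
def singletonCount (n : ℕ) (F : Finset (ℕ × ℕ)) (δ i : ℕ) : ℕ :=
  (F.filter fun p => i ≤ p.1 ∧ p.2 + (δ - 1 - i) < n).card

/-- `C` is an `[m × n, k, δ]` rank-metric code over `K`: it is a `k`-dimensional linear space of
matrices whose minimum rank distance is exactly `δ`. -/
structure IsRankMetricCode {K : Type*} [Field K] {m n : ℕ}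
    (C : Submodule K (Matrix (Fin m) (Fin n) K)) (k δ : ℕ) : Prop where
  dim : Module.finrank K C = k
  minDist : IsLeast {d : ℕ | ∃ A ∈ C, ∃ B ∈ C, A ≠ B ∧ d = (A - B).rank} δ

/-- `C` is an `[F, k, δ]` Ferrers diagram rank-metric code over `K`: a rank-metric code whose
matrices vanish outside `F`. -/
structure IsFDRMCode {K : Type*} [Field K] {m n : ℕ} (F : Finset (ℕ × ℕ))
    (C : Submodule K (Matrix (Fin m) (Fin n) K)) (k δ : ℕ) : Prop
    extends IsRankMetricCode C k δ where
  support : ∀ A ∈ C, ∀ (i : Fin m) (j : Fin n), ((i : ℕ), (j : ℕ)) ∉ F → A i j = 0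

/-- An optimal `[F, k, δ]` code: its dimension attains the Singleton-like upper bound
`min_{0 ≤ i ≤ δ - 1} v_i`, where `v_i = singletonCount n F δ i`. -/
structure IsOptimalFDRMCode {K : Type*} [Field K] {m n : ℕ} (F : Finset (ℕ × ℕ))
    (C : Submodule K (Matrix (Fin m) (Fin n) K)) (k δ : ℕ) : Prop
    extends IsFDRMCode F C k δ where
  optimal : IsLeast {v : ℕ | ∃ i, i < δ ∧ v = singletonCount n F δ i} k

/-! ### Rank inequalities for block matrices and for matrices with restricted support. -/

section Rank

variable {K : Type*} [Field K]

/-! The Singleton-like bound with `i = δ - 1` counts the dots from row `δ - 1` on. Hence it suffices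
to find a linear code on `F` whose nonzero words have rank at least `δ` and in which these dots can
be filled arbitrarily (`isOptimalFDRMCode_of_systematic`).

Store all dots outside the full upper right block as the rows of one matrix `N`: the reversed rows
of `F₁`, the columns of `F₃` and the single dot, `m₁ + n₃ + 1` rows in all. Folding `N` back into
the array never lowers its rank, whatever stands in the upper right block (`rank_le_rank_assemble`).
When `N = 0`, the rank comes from a separate code on that block. It remains to build a code for `N`
of distance at least `δ` in which all but the first `δ - 1` rows can be prescribed.

Put `μ = ρ_{δ-2}(F₁)`. Prescribed rows have at most `μ` dots, free rows at least `μ`, and the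
sorting condition forces `μ ≥ m₁ + n₃`. If this is strict, evaluate linearized polynomials over the
extension of degree `μ` at independent points, as for Gabidulin codes (`exists_systematicRowCode`).

If `μ = m₁ + n₃`, there is one row too many (`exists_systematicRowCode_of_one`). Let `s(x) = x^q -
γ^(q-1) x`, with kernel `Kγ`, and let `θ` lie outside the image of `s`. A word is given by a
linearized `h` and a scalar `b`: the first row is `(h(θ), b)`, one place longer than `μ`, and the
other rows are `h(s(g)) + b g`. At `g = γ` this is `bγ`, so the dot row has a single entry. For `b =
0`, the rows other than the dot row evaluate `h` at `μ` independent points. For `b ≠ 0`, the rows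
other than the first evaluate the nonzero map `h ∘ s + b`; its larger kernel is compensated by the
extra entry `b`, alone in its column. -/

theorem rank_fromBlocks_zero_ge {a b c d : Type*} [Finite a] [Fintype b] [Finite c] [Fintype d]
    (X : Matrix a b K) (Y : Matrix a d K) (Z : Matrix c d K) :
    X.rank + Z.rank ≤ (Matrix.fromBlocks X Y 0 Z).rank := by
  classical
  set T := (Matrix.fromBlocks X Y 0 Z).mulVecLin with hT
  have happ : ∀ (u : b → K) (v : d → K), T (Sum.elim u v) =
      Sum.elim (X.mulVec u + Y.mulVec v) (Z.mulVec v) := by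
    intro u v
    simp [hT, Matrix.fromBlocks_mulVec]
  let π : (a ⊕ c → K) →ₗ[K] (c → K) := LinearMap.funLeft K K Sum.inr
  let π' := π.domRestrict (LinearMap.range T)
  have h := LinearMap.finrank_range_add_finrank_ker π'
  have h1 : Module.finrank K (LinearMap.range Z.mulVecLin) ≤
      Module.finrank K (LinearMap.range π') := by
    apply Submodule.finrank_mono
    rintro _ ⟨v, rfl⟩
    refine ⟨⟨T (Sum.elim 0 v), ⟨_, rfl⟩⟩, ?_⟩
    ext i
    simp [π', π, happ, LinearMap.funLeft]
  let j : (a → K) →ₗ[K] (a ⊕ c → K) :=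
    { toFun := fun y => Sum.elim y 0
      map_add' := fun x y => by ext (i | i) <;> simp
      map_smul' := fun r x => by ext (i | i) <;> simp }
  have hj : ∀ y : LinearMap.range X.mulVecLin, j y.1 ∈ LinearMap.range T := by
    rintro ⟨_, u, rfl⟩
    refine ⟨Sum.elim u 0, ?_⟩
    rw [happ]
    simp [j]
  let J : LinearMap.range X.mulVecLin →ₗ[K] LinearMap.ker π' :=
    LinearMap.codRestrict _ (LinearMap.codRestrict _ (j.domRestrict _) hj) (by
      intro y
      rw [LinearMap.mem_ker]
      ext i
      change j y.1 (Sum.inr i) = 0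
      simp [j])
  have hJ : Function.Injective J := by
    intro x y hxy
    have h3 : j x.1 = j y.1 := congrArg (fun z => (z.1.1 : a ⊕ c → K)) hxy
    ext i
    exact congrFun h3 (Sum.inl i)
  have h2 := LinearMap.finrank_le_finrank_of_injective hJ
  change Module.finrank K (LinearMap.range X.mulVecLin) +
    Module.finrank K (LinearMap.range Z.mulVecLin) ≤ Module.finrank K (LinearMap.range T)
  omega

/-- Bordering the submatrix with row `i` and column `j` gives a block triangular matrix whose 1×1
corner is invertible. -/
theorem rank_submatrix_lt_of_entry_ne_zero {m n m' n' : Type*} [Finite m] [Fintype n] [Finite m']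
    [Fintype n'] (A : Matrix m n K) (f : m' → m) (g : n' → n) (i : m) (j : n)
    (hij : A i j ≠ 0) (h : ∀ i', A (f i') j = 0) : (A.submatrix f g).rank < A.rank := by
  have h1 : A.submatrix (Sum.elim (fun _ : Unit => i) f) (Sum.elim (fun _ : Unit => j) g) =
      Matrix.fromBlocks (A.submatrix (fun _ : Unit => i) (fun _ : Unit => j))
        (A.submatrix (fun _ : Unit => i) g) 0 (A.submatrix f g) := by
    ext (a | a) (b | b) <;> simp [h]
  have h2 := rank_fromBlocks_zero_ge (A.submatrix (fun _ : Unit => i) (fun _ : Unit => j))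
    (A.submatrix (fun _ : Unit => i) g) (A.submatrix f g)
  rw [← h1] at h2
  have h3 := h2.trans (Matrix.rank_submatrix_le A _ _)
  have h4 : (A.submatrix (fun _ : Unit => i) (fun _ : Unit => j)).rank = Fintype.card Unit :=
    Matrix.rank_of_det_ne_zero (by simpa using hij)
  rw [h4, Fintype.card_unit] at h3
  omega

theorem rank_le_rank_submatrix_of_support {a b c : Type*} [Finite a] [Fintype b] [Fintype c]
    (U : Matrix a b K) (g : c → b) (h : ∀ i j, j ∉ Set.range g → U i j = 0) :
    U.rank ≤ (U.submatrix id g).rank := by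
  rw [Matrix.rank_eq_finrank_span_cols, Matrix.rank_eq_finrank_span_cols]
  refine Submodule.finrank_mono ?_
  rw [Submodule.span_le]
  rintro _ ⟨j, rfl⟩
  by_cases hj : j ∈ Set.range g
  · obtain ⟨k, rfl⟩ := hj
    exact Submodule.subset_span ⟨k, rfl⟩
  · have h0 : U.col j = 0 := funext fun i => h i j hj
    rw [h0]
    exact Submodule.zero_mem _

theorem rank_add_le_rank_add {a b : Type*} [Finite a] [Fintype b] (X Y : Matrix a b K) :
    (X + Y).rank ≤ X.rank + Y.rank := by
  have h : LinearMap.range (X + Y).mulVecLin ≤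
      LinearMap.range X.mulVecLin ⊔ LinearMap.range Y.mulVecLin := by
    rintro _ ⟨u, rfl⟩
    rw [Matrix.mulVecLin_add, LinearMap.add_apply]
    exact Submodule.add_mem_sup ⟨u, rfl⟩ ⟨u, rfl⟩
  exact (Submodule.finrank_mono h).trans (Submodule.finrank_add_le_finrank_add_finrank _ _)

theorem rank_fromRows_zero {a b c : Type*} [Finite a] [Fintype b] [Finite c]
    (X : Matrix a b K) :
    (Matrix.fromRows X (0 : Matrix c b K)).rank ≤ X.rank := by
  have := Fintype.ofFinite a
  classical
  have h : Matrix.fromRows X (0 : Matrix c b K) = Matrix.fromRows (1 : Matrix a a K) 0 * X := by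
    rw [Matrix.fromRows_mul]; simp
  rw [h]
  exact Matrix.rank_mul_le_right _ _

theorem rank_zero_fromRows {a b c : Type*} [Finite a] [Fintype b] [Finite c]
    (X : Matrix a b K) :
    (Matrix.fromRows (0 : Matrix c b K) X).rank ≤ X.rank := by
  have := Fintype.ofFinite a
  classical
  have h : Matrix.fromRows (0 : Matrix c b K) X = Matrix.fromRows 0 (1 : Matrix a a K) * X := by
    rw [Matrix.fromRows_mul]; simp
  rw [h]
  exact Matrix.rank_mul_le_right _ _

theorem rank_fromRows_le {a b c : Type*} [Finite a] [Fintype b] [Finite c]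
    (X : Matrix a b K) (Y : Matrix c b K) :
    (Matrix.fromRows X Y).rank ≤ X.rank + Y.rank := by
  have h : Matrix.fromRows X Y = Matrix.fromRows X 0 + Matrix.fromRows 0 Y := by
    ext (i | i) j <;> simp
  rw [h]
  exact (rank_add_le_rank_add _ _).trans
    (Nat.add_le_add (rank_fromRows_zero X) (rank_zero_fromRows Y))

/-- A matrix supported on the union of the rows in `R` and the columns in `S`. -/
theorem rank_le_card_rows_add_card_cols {a b : Type*} [Fintype a] [Fintype b]
    (A : Matrix a b K) (R : Finset a) (S : Finset b)
    (h : ∀ i j, i ∉ R → j ∉ S → A i j = 0) : A.rank ≤ R.card + S.card := by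
  classical
  have hA : A = Matrix.of (fun i j => if i ∈ R then A i j else 0) +
      Matrix.of (fun i j => if i ∈ R then 0 else A i j) := by
    ext i j
    by_cases hi : i ∈ R <;> simp [hi]
  rw [hA]
  refine (rank_add_le_rank_add _ _).trans (Nat.add_le_add ?_ ?_)
  · rw [Matrix.rank_eq_finrank_span_row]
    have : Submodule.span K (Set.range (Matrix.of (fun i j => if i ∈ R then A i j else 0)).row) ≤
        Submodule.span K ((R.image fun i => A i : Finset (b → K)) : Set (b → K)) := by
      rw [Submodule.span_le]
      rintro _ ⟨i, rfl⟩
      by_cases hi : i ∈ R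
      · apply Submodule.subset_span
        simp only [Finset.coe_image]
        refine ⟨i, hi, ?_⟩
        ext j
        simp [Matrix.row, hi]
      · have h0 : (Matrix.of (fun i j => if i ∈ R then A i j else 0)).row i = 0 := by
          ext j
          simp [Matrix.row, hi]
        rw [h0]
        exact Submodule.zero_mem _
    exact (Submodule.finrank_mono this).trans
      ((finrank_span_finset_le_card _).trans Finset.card_image_le)
  · rw [Matrix.rank_eq_finrank_span_cols]
    have : Submodule.span K (Set.range (Matrix.of (fun i j => if i ∈ R then 0 else A i j)).col) ≤
        Submodule.span K ((S.image fun j => (Matrix.of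
          (fun i j => if i ∈ R then 0 else A i j)).col j : Finset (a → K)) : Set (a → K)) := by
      rw [Submodule.span_le]
      rintro _ ⟨j, rfl⟩
      by_cases hj : j ∈ S
      · apply Submodule.subset_span
        simp only [Finset.coe_image]
        exact ⟨j, hj, rfl⟩
      · have h0 : (Matrix.of (fun i j => if i ∈ R then 0 else A i j)).col j = 0 := by
          ext i
          by_cases hi : i ∈ R
          · simp [Matrix.col, hi]
          · simp [Matrix.col, hi, h i j hi hj]
        rw [h0]
        exact Submodule.zero_mem _
    exact (Submodule.finrank_mono this).trans
      ((finrank_span_finset_le_card _).trans Finset.card_image_le)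

end Rank

/-! ### The Singleton-like bound and optimality of systematic codes. -/

section Singleton

variable {K : Type*} [Field K] {m n : ℕ}

/-- The Singleton-like bound for Ferrers diagram codes. -/
theorem finrank_le_singletonCount {F : Finset (ℕ × ℕ)}
    (hsub : ∀ i j, (i, j) ∈ F → i < m ∧ j < n)
    (C : Submodule K (Matrix (Fin m) (Fin n) K))
    (hsupp : ∀ A ∈ C, ∀ (i : Fin m) (j : Fin n), ((i : ℕ), (j : ℕ)) ∉ F → A i j = 0)
    {δ : ℕ} (hrank : ∀ A ∈ C, A ≠ 0 → δ ≤ A.rank) {i : ℕ} (hi : i < δ) :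
    Module.finrank K C ≤ singletonCount n F δ i := by
  classical
  set G := F.filter fun p => i ≤ p.1 ∧ p.2 + (δ - 1 - i) < n with hG
  have hGF : ∀ p ∈ G, p.1 < m ∧ p.2 < n := fun p hp => hsub _ _ (Finset.mem_filter.1 hp).1
  let f : C →ₗ[K] (G → K) :=
    { toFun := fun A p => A.1 ⟨p.1.1, (hGF p.1 p.2).1⟩ ⟨p.1.2, (hGF p.1 p.2).2⟩
      map_add' := fun A B => by ext; simp
      map_smul' := fun r A => by ext; simp }
  have hf : Function.Injective f := by
    rw [injective_iff_map_eq_zero]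
    rintro ⟨A, hA⟩ hA0
    by_contra hne
    have hne' : A ≠ 0 := fun h => hne (by ext1; exact h)
    have h1 := hrank A hA hne'
    have h2 := rank_le_card_rows_add_card_cols A
      (Finset.univ.filter fun k : Fin m => (k : ℕ) < i)
      (Finset.univ.filter fun l : Fin n => n ≤ (l : ℕ) + (δ - 1 - i)) (by
        intro k l hk hl
        simp only [Finset.mem_filter, Finset.mem_univ, true_and, not_lt, not_le] at hk hl
        by_cases hF : ((k : ℕ), (l : ℕ)) ∈ F
        · have := congrFun hA0 ⟨((k : ℕ), (l : ℕ)), by simp [hG, hF, hk, hl]⟩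
          simpa [f] using this
        · exact hsupp A hA k l hF)
    have h3 : (Finset.univ.filter fun k : Fin m => (k : ℕ) < i).card ≤ i := by
      have := Finset.card_le_card_of_injOn (s := Finset.univ.filter fun k : Fin m => (k : ℕ) < i)
        (t := Finset.range i) (fun k => (k : ℕ)) (by intro k; simp)
        (by intro x _ y _ h; exact Fin.ext h)
      simpa using this
    have h4 : (Finset.univ.filter fun l : Fin n => n ≤ (l : ℕ) + (δ - 1 - i)).card
        ≤ δ - 1 - i := by
      have := Finset.card_le_card_of_injOn
        (s := Finset.univ.filter fun l : Fin n => n ≤ (l : ℕ) + (δ - 1 - i))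
        (t := Finset.range (δ - 1 - i)) (fun l => n - 1 - (l : ℕ))
        (by intro l; have := l.2; simp; omega)
        (by intro x _ y _ h; have := x.2; have := y.2; simp at h; apply Fin.ext; omega)
      simpa using this
    omega
  have := LinearMap.finrank_le_finrank_of_injective hf
  simpa [singletonCount, hG] using this

/-- A code of minimum distance at least `δ` whose words can be prescribed below row `δ - 1` is
optimal. -/
theorem isOptimalFDRMCode_of_systematic {F : Finset (ℕ × ℕ)} (hF : IsFerrersDiagram m n F)
    (C : Submodule K (Matrix (Fin m) (Fin n) K))
    (hsupp : ∀ A ∈ C, ∀ (i : Fin m) (j : Fin n), ((i : ℕ), (j : ℕ)) ∉ F → A i j = 0)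
    {δ : ℕ} (hδ : 1 ≤ δ) (hδm : δ ≤ m) (hrank : ∀ A ∈ C, A ≠ 0 → δ ≤ A.rank)
    (hsys : ∀ z : ℕ → ℕ → K, ∃ A ∈ C, ∀ (i : Fin m) (j : Fin n), δ - 1 ≤ (i : ℕ) →
      ((i : ℕ), (j : ℕ)) ∈ F → A i j = z i j) :
    IsOptimalFDRMCode F C (∑ i ∈ Finset.Ico (δ - 1) m, rowDots F i) δ := by
  classical
  set k := ∑ i ∈ Finset.Ico (δ - 1) m, rowDots F i with hk
  have hkv : k = (F.filter fun p => δ - 1 ≤ p.1).card := by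
    rw [Finset.card_eq_sum_card_fiberwise (f := Prod.fst) (t := Finset.Ico (δ - 1) m)]
    · refine Finset.sum_congr rfl fun i hi => ?_
      rw [rowDots, Finset.filter_filter]
      congr 1
      ext p
      simp only [Finset.mem_filter, Finset.mem_Ico] at hi ⊢
      constructor
      · rintro ⟨h, rfl⟩; exact ⟨h, hi.1, rfl⟩
      · rintro ⟨h, _, h'⟩; exact ⟨h, h'⟩
    · rintro ⟨i, j⟩ hp
      rw [Finset.mem_coe, Finset.mem_filter] at hp
      rw [Finset.mem_coe, Finset.mem_Ico]
      exact ⟨hp.2, (hF.subset _ _ hp.1).1⟩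
  have hge : k ≤ Module.finrank K C := by
    set G := F.filter fun p => δ - 1 ≤ p.1 with hG
    have hGF : ∀ p ∈ G, p.1 < m ∧ p.2 < n :=
      fun p hp => hF.subset _ _ (Finset.mem_filter.1 hp).1
    let f : C →ₗ[K] (G → K) :=
      { toFun := fun A p => A.1 ⟨p.1.1, (hGF p.1 p.2).1⟩ ⟨p.1.2, (hGF p.1 p.2).2⟩
        map_add' := fun A B => by ext; simp
        map_smul' := fun r A => by ext; simp }
    have hf : Function.Surjective f := by
      intro z
      obtain ⟨A, hA, hAz⟩ := hsys fun i j => if h : (i, j) ∈ G then z ⟨(i, j), h⟩ else 0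
      refine ⟨⟨A, hA⟩, ?_⟩
      ext ⟨⟨i, j⟩, hp⟩
      have hp' := Finset.mem_filter.1 hp
      have := hAz ⟨i, (hGF _ hp).1⟩ ⟨j, (hGF _ hp).2⟩ hp'.2 hp'.1
      simpa [f, hp] using this
    have h2 := LinearMap.finrank_range_add_finrank_ker f
    rw [LinearMap.range_eq_top.2 hf, finrank_top, Module.finrank_fintype_fun_eq_card,
      Fintype.card_coe] at h2
    omega
  have hsub := hF.subset
  have hlast : k = singletonCount n F δ (δ - 1) := by
    rw [hkv, singletonCount]
    congr 1
    ext p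
    simp only [Finset.mem_filter, and_congr_right_iff]
    intro hp
    have := (hsub _ _ hp).2
    omega
  have hdim : Module.finrank K C = k := by
    refine le_antisymm ?_ hge
    rw [hlast]
    exact finrank_le_singletonCount hsub C hsupp hrank (by omega)
  -- If distance `δ + 1` held, the Singleton bound would leave only the dots from row `δ` on, and so
  -- lose the dot `(δ - 1, n - 1)`.
  have hattain : ∃ A ∈ C, A ≠ 0 ∧ A.rank = δ := by
    by_contra! hno
    have h1 := finrank_le_singletonCount hsub C hsupp (δ := δ + 1) (i := δ)
      (fun A hA h0 => Nat.lt_of_le_of_ne (hrank A hA h0) (Ne.symm (hno A hA h0)))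
      (Nat.lt_succ_self δ)
    have h2 : singletonCount n F (δ + 1) δ < (F.filter fun p => δ - 1 ≤ p.1).card := by
      refine Finset.card_lt_card ?_
      rw [Finset.ssubset_iff_of_subset]
      · refine ⟨(δ - 1, n - 1), ?_, ?_⟩
        · exact Finset.mem_filter.2 ⟨hF.last_col (δ - 1) (by omega), le_rfl⟩
        · simp only [Finset.mem_filter]
          omega
      · intro p hp
        simp only [Finset.mem_filter] at hp ⊢
        exact ⟨hp.1, by omega⟩
    omega
  refine ⟨⟨⟨hdim, ?_, ?_⟩, hsupp⟩, ⟨δ - 1, by omega, hlast⟩, ?_⟩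
  · obtain ⟨A, hA, h0, hr⟩ := hattain
    exact ⟨A, hA, 0, C.zero_mem, h0, by rw [sub_zero, hr]⟩
  · rintro _ ⟨A, hA, B, hB, hne, rfl⟩
    exact hrank _ (C.sub_mem hA hB) (sub_ne_zero.2 hne)
  · rintro _ ⟨i, hi, rfl⟩
    rw [← hdim]
    exact finrank_le_singletonCount hsub C hsupp hrank hi

end Singleton

/-! ### Rank of a matrix whose rows are values of a linear map. -/

section Evaluation

variable {K L : Type*} [Field K] [Field L] [Algebra K L] [FiniteDimensional K L]

/-- Rank-nullity on the span of `g`: its image under `f` is the row space of `A`. -/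
theorem card_le_rank_add_finrank_ker {ι : Type*} [Fintype ι] {w : ℕ} {g : ι → L}
    (hg : LinearIndependent K g) (f : L →ₗ[K] (Fin w → K)) (A : Matrix ι (Fin w) K)
    (hA : ∀ i, A i = f (g i)) :
    Fintype.card ι ≤ A.rank + Module.finrank K (LinearMap.ker f) := by
  set W := Submodule.span K (Set.range g)
  have h0 : Module.finrank K W = Fintype.card ι := finrank_span_eq_card hg
  have h := LinearMap.finrank_range_add_finrank_ker (f.domRestrict W)
  have h1 : Module.finrank K (LinearMap.range (f.domRestrict W)) = A.rank := by
    rw [Matrix.rank_eq_finrank_span_row, LinearMap.range_domRestrict, Submodule.map_span,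
      ← Set.range_comp]
    have : A.row = f ∘ g := funext hA
    rw [this]
  have h2 : Module.finrank K (LinearMap.ker (f.domRestrict W)) ≤
      Module.finrank K (LinearMap.ker f) := by
    refine LinearMap.finrank_le_finrank_of_injective
      (f := LinearMap.codRestrict (LinearMap.ker f)
        (W.subtype.domRestrict (LinearMap.ker (f.domRestrict W))) fun x => x.2) ?_
    intro x y hxy
    have : (x.1.1 : L) = y.1.1 := congrArg (fun z => (z.1 : L)) hxy
    exact Subtype.ext (Subtype.ext this)
  omega

end Evaluation

/-! ### Linearized polynomials: kernel bounds and interpolation. -/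

section LinearizedPolynomials

variable {K L : Type*} [Field K] [Fintype K] [Field L] [Algebra K L]

/-- The `K`-linear map `x ↦ ∑ i, a i * x ^ (q ^ i)` given by a linearized polynomial, where `q` is
the cardinality of `K`. -/
noncomputable def linearizedMap (K : Type*) {L : Type*} [Field K] [Fintype K] [Field L] [Algebra K L]
    {k : ℕ} : (Fin k → L) →ₗ[L] (L →ₗ[K] L) :=
  Fintype.linearCombination L fun i : Fin k =>
    ((FiniteField.frobeniusAlgHom K L) ^ (i : ℕ)).toLinearMap

theorem linearizedMap_apply {k : ℕ} (a : Fin k → L) (x : L) :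
    linearizedMap K a x = ∑ i, a i * x ^ (Fintype.card K ^ (i : ℕ)) := by
  simp [linearizedMap, Fintype.linearCombination_apply, LinearMap.sum_apply,
    FiniteField.coe_frobeniusAlgHom, pow_iterate]

/-- The polynomial `∑ i, a i * X ^ (q ^ i)`. -/
noncomputable def linearizedPoly (q : ℕ) {k : ℕ} (a : Fin k → L) : Polynomial L :=
  ∑ i, Polynomial.C (a i) * Polynomial.X ^ (q ^ (i : ℕ))

theorem eval_linearizedPoly {k : ℕ} (a : Fin k → L) (x : L) :
    (linearizedPoly (Fintype.card K) a).eval x = linearizedMap K a x := by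
  simp [linearizedPoly, linearizedMap_apply, Polynomial.eval_finsetSum]

theorem natDegree_linearizedPoly_le {q : ℕ} (hq : 1 < q) {k d : ℕ} (h : k ≤ d + 1)
    (a : Fin k → L) : (linearizedPoly q a).natDegree ≤ q ^ d := by
  refine Polynomial.natDegree_sum_le_of_forall_le _ _ fun i _ => ?_
  refine (Polynomial.natDegree_C_mul_X_pow_le _ _).trans ?_
  exact Nat.pow_le_pow_right (by omega) (by omega)

theorem linearizedPoly_ne_zero {q : ℕ} (hq : 1 < q) {k : ℕ} {a : Fin k → L} (ha : a ≠ 0) :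
    linearizedPoly q a ≠ 0 := by
  intro h
  apply ha
  ext i
  have := congrArg (fun p => Polynomial.coeff p (q ^ (i : ℕ))) h
  simp only [linearizedPoly, Polynomial.finsetSum_coeff, Polynomial.coeff_C_mul_X_pow,
    Polynomial.coeff_zero] at this
  rw [Finset.sum_eq_single i] at this
  · simpa using this
  · intro j _ hj
    rw [if_neg]
    intro h
    exact hj (Fin.ext (Nat.pow_right_injective hq h.symm))
  · simp

variable [FiniteDimensional K L]

/-- Kernel elements are roots of `p`, so `q ^ dim ker ≤ deg p ≤ q ^ d`. -/
theorem finrank_ker_le_of_eval (f : L →ₗ[K] L) {p : Polynomial L} (hp : p ≠ 0) {d : ℕ}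
    (hd : p.natDegree ≤ Fintype.card K ^ d) (hf : ∀ x, p.eval x = f x) :
    Module.finrank K (LinearMap.ker f) ≤ d := by
  classical
  have := Module.finite_of_finite K (M := L)
  have := Fintype.ofFinite L
  have h1 : Fintype.card (LinearMap.ker f) ≤ p.roots.toFinset.card := by
    rw [← Fintype.card_coe]
    refine Fintype.card_le_of_injective
      (fun x => ⟨x.1, by
        have hx : f x.1 = 0 := x.2
        simp [hp, hf, hx]⟩) ?_
    intro x y h
    exact Subtype.ext (congrArg (fun z => (z.1 : L)) h)
  have h2 := (Multiset.toFinset_card_le p.roots).trans p.card_roots'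
  rw [Module.card_eq_pow_finrank (K := K)] at h1
  exact (Nat.pow_le_pow_iff_right Fintype.one_lt_card).1 (h1.trans (h2.trans hd))

theorem finrank_ker_linearizedMap_lt {k : ℕ} {a : Fin k → L} (ha : a ≠ 0) :
    Module.finrank K (LinearMap.ker (linearizedMap K a)) < k := by
  have hk : k ≠ 0 := by
    rintro rfl
    exact ha (Subsingleton.elim _ _)
  have := finrank_ker_le_of_eval (linearizedMap K a)
    (linearizedPoly_ne_zero (q := Fintype.card K) Fintype.one_lt_card ha) (d := k - 1)
    (natDegree_linearizedPoly_le Fintype.one_lt_card (by omega) a) (eval_linearizedPoly a)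
  omega

/-- Evaluation at `k` independent points is injective by the kernel bound, hence bijective by
dimension. -/
theorem exists_linearizedMap_interpolation {ι : Type*} [Fintype ι] {k : ℕ}
    (hk : Fintype.card ι = k) {g : ι → L} (hg : LinearIndependent K g) (y : ι → L) :
    ∃ a : Fin k → L, ∀ i, linearizedMap K a (g i) = y i := by
  let ev : (Fin k → L) →ₗ[L] (ι → L) :=
    { toFun := fun a i => linearizedMap K a (g i)
      map_add' := fun a b => by ext; simp
      map_smul' := fun r a => by ext; simp }
  have hinj : Function.Injective ev := by
    rw [injective_iff_map_eq_zero]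
    intro a ha
    by_contra hne
    have h1 := finrank_ker_linearizedMap_lt (K := K) hne
    have h2 : Submodule.span K (Set.range g) ≤ LinearMap.ker (linearizedMap K a) := by
      rw [Submodule.span_le]
      rintro _ ⟨i, rfl⟩
      exact congrFun ha i
    have h3 := Submodule.finrank_mono h2
    rw [finrank_span_eq_card hg] at h3
    omega
  have hsurj : Function.Surjective ev :=
    (LinearMap.injective_iff_surjective_of_finrank_eq_finrank (by simp [hk])).1 hinj
  obtain ⟨a, ha⟩ := hsurj y
  exact ⟨a, congrFun ha⟩

end LinearizedPolynomials

/-! ### Coordinates of extension field elements, with room for one extra scalar at position `μ`. -/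

section Pad

variable {K L : Type*} [Field K] [Field L] [Algebra K L] {μ : ℕ}

/-- The vector of length `w` whose first entries are the coordinates of an element of `L`, followed
by a further entry from `K` and zeros. -/
noncomputable def padVec (e : Module.Basis (Fin μ) K L) (w : ℕ) : L × K →ₗ[K] (Fin w → K) where
  toFun z t := if h : (t : ℕ) < μ then e.repr z.1 ⟨t, h⟩ else if (t : ℕ) = μ then z.2 else 0
  map_add' x y := by
    ext t
    by_cases h : (t : ℕ) < μ
    · simp [h]
    · by_cases h' : (t : ℕ) = μ <;> simp [h, h']
  map_smul' r x := by
    ext t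
    by_cases h : (t : ℕ) < μ
    · simp [h]
    · by_cases h' : (t : ℕ) = μ <;> simp [h, h']

theorem padVec_of_lt (e : Module.Basis (Fin μ) K L) {w : ℕ} (z : L × K) (t : Fin w)
    (h : (t : ℕ) < μ) : padVec e w z t = e.repr z.1 ⟨t, h⟩ := by
  simp [padVec, h]

theorem padVec_of_eq (e : Module.Basis (Fin μ) K L) {w : ℕ} (z : L × K) (t : Fin w)
    (h : (t : ℕ) = μ) : padVec e w z t = z.2 := by
  simp [padVec, h]

theorem padVec_of_gt (e : Module.Basis (Fin μ) K L) {w : ℕ} (z : L × K) (t : Fin w)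
    (h : μ < (t : ℕ)) : padVec e w z t = 0 := by
  simp [padVec, h.not_gt, h.ne']

theorem padVec_zero_of_le (e : Module.Basis (Fin μ) K L) {w : ℕ} (y : L) (t : Fin w)
    (h : μ ≤ (t : ℕ)) : padVec e w (y, 0) t = 0 := by
  rcases h.eq_or_lt with h | h
  · rw [padVec_of_eq _ _ _ h.symm]
  · rw [padVec_of_gt _ _ _ h]

theorem ker_padVec_inl (e : Module.Basis (Fin μ) K L) {w : ℕ} (hw : μ ≤ w) :
    LinearMap.ker (padVec e w ∘ₗ LinearMap.inl K L K) = ⊥ := by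
  rw [LinearMap.ker_eq_bot']
  intro y hy
  apply e.repr.injective
  ext t
  have := congrFun hy ⟨t, t.2.trans_le hw⟩
  rw [LinearMap.comp_apply, padVec_of_lt _ _ _ (show (⟨t, _⟩ : Fin w).1 < μ from t.2)] at this
  simpa using this

theorem padVec_ofVec (e : Module.Basis (Fin μ) K L) {w : ℕ} (x : ℕ → K) (t : Fin w)
    (h : (t : ℕ) < μ) : padVec e w (e.equivFun.symm fun i => x i, 0) t = x t := by
  rw [padVec_of_lt _ _ _ h, ← e.equivFun_apply, LinearEquiv.apply_symm_apply]

end Pad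

/-! ### Systematic row codes from linearized polynomials. -/

section DiagonalCode

variable {K : Type*} [Field K] [Fintype K] {ι : Type*} [Fintype ι] [DecidableEq ι]

/-- `D` consists of matrices with row `i` supported on its first `α i` entries. Its nonzero words
have rank greater than the number of rows outside `S`, and the rows in `S` can be prescribed. -/
structure IsSystematicRowCode {w : ℕ} (S : Finset ι) (α : ι → ℕ)
    (D : Submodule K (Matrix ι (Fin w) K)) : Prop where
  support : ∀ A ∈ D, ∀ i (t : Fin w), α i ≤ t → A i t = 0
  rank : ∀ A ∈ D, A ≠ 0 → Fintype.card ι < A.rank + S.card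
  systematic : ∀ x : ι → ℕ → K, ∃ A ∈ D, ∀ i ∈ S, ∀ t : Fin w, (t : ℕ) < α i → A i t = x i t

theorem exists_extension (K : Type*) [Field K] [Fintype K] (μ : ℕ) (hμ : 0 < μ) :
    ∃ (L : Type) (_ : Field L) (_ : Algebra K L) (_ : FiniteDimensional K L),
      Module.finrank K L = μ := by
  obtain ⟨p, hp⟩ := CharP.exists K
  have : Fact p.Prime := ⟨CharP.char_is_prime K p⟩
  have : NeZero μ := ⟨hμ.ne'⟩
  exact ⟨FiniteField.Extension K p μ, inferInstance, inferInstance, inferInstance,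
    FiniteField.finrank_extension K p μ⟩

/-- The systematic code obtained from a linearized polynomial (Gabidulin) code. -/
theorem exists_systematicRowCode {μ w : ℕ} (S : Finset ι) (α : ι → ℕ) (hμ : 0 < μ)
    (hcard : Fintype.card ι ≤ μ) (hS : ∀ i ∈ S, α i ≤ μ) (hS' : ∀ i ∉ S, μ ≤ α i)
    (hw : μ ≤ w) :
    ∃ D : Submodule K (Matrix ι (Fin w) K), IsSystematicRowCode S α D := by
  obtain ⟨L, _, _, _, hL⟩ := exists_extension K μ hμ
  have e : Module.Basis (Fin μ) K L := Module.finBasisOfFinrankEq K L hL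
  obtain ⟨σ⟩ : Nonempty (ι ↪ Fin μ) :=
    Function.Embedding.nonempty_of_card_le (by simpa using hcard)
  set g : ι → L := e ∘ σ with hg
  have hgi : LinearIndependent K g := e.linearIndependent.comp _ σ.injective
  let ψ : L →ₗ[K] (Fin w → K) := padVec e w ∘ₗ LinearMap.inl K L K
  have hψ : LinearMap.ker ψ = ⊥ := ker_padVec_inl e hw
  -- The support condition is imposed only on `S`: the other rows have room for all `μ` coordinates.
  let D : Submodule K (Matrix ι (Fin w) K) :=
    { carrier := {A | (∃ a : Fin S.card → L, ∀ i, A i = ψ (linearizedMap K a (g i))) ∧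
        ∀ i ∈ S, ∀ t : Fin w, α i ≤ t → A i t = 0}
      zero_mem' := ⟨⟨0, fun i => by
        rw [map_zero, LinearMap.zero_apply, map_zero]; rfl⟩, fun _ _ _ _ => rfl⟩
      add_mem' := by
        rintro A B ⟨⟨a, ha⟩, hA⟩ ⟨⟨b, hb⟩, hB⟩
        refine ⟨⟨a + b, fun i => ?_⟩, fun i hi t ht => ?_⟩
        · change A i + B i = _
          rw [ha, hb]; simp
        · change A i t + B i t = 0
          rw [hA i hi t ht, hB i hi t ht, add_zero]
      smul_mem' := by
        rintro r A ⟨⟨a, ha⟩, hA⟩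
        refine ⟨⟨algebraMap K L r • a, fun i => ?_⟩, fun i hi t ht => ?_⟩
        · change r • A i = _
          rw [ha, map_smul, LinearMap.smul_apply, algebraMap_smul, map_smul]
        · change r • A i t = 0
          rw [hA i hi t ht, smul_zero] }
  refine ⟨D, ?_, ?_, ?_⟩
  · rintro A ⟨⟨a, ha⟩, hA⟩ i t ht
    by_cases hi : i ∈ S
    · exact hA i hi t ht
    · rw [ha]
      exact padVec_zero_of_le e _ t ((hS' i hi).trans ht)
  · rintro A ⟨⟨a, ha⟩, -⟩ hA0
    have ha0 : a ≠ 0 := by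
      rintro rfl
      apply hA0
      ext i t
      rw [ha]; simp
    have h1 := finrank_ker_linearizedMap_lt (K := K) ha0
    have h2 := card_le_rank_add_finrank_ker hgi (ψ ∘ₗ linearizedMap K a) A ha
    rw [LinearMap.ker_comp_of_ker_eq_bot _ hψ] at h2
    omega
  · intro x
    -- Truncating the targets to `α i` entries makes the interpolating word satisfy the support
    -- condition.
    let y : S → L := fun i => e.equivFun.symm fun t => if (t : ℕ) < α i then x i t else 0
    obtain ⟨a, ha⟩ := exists_linearizedMap_interpolation (K := K) (ι := S) (Fintype.card_coe S)
      (hgi.comp (Subtype.val : S → ι) Subtype.val_injective) y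
    have key : ∀ (i) (hi : i ∈ S) (t : Fin w), (t : ℕ) < μ →
        ψ (linearizedMap K a (g i)) t = if (t : ℕ) < α i then x i t else 0 := by
      intro i hi t ht
      rw [show linearizedMap K a (g i) = y ⟨i, hi⟩ from ha ⟨i, hi⟩]
      exact padVec_ofVec e (fun t => if t < α i then x i t else 0) t ht
    refine ⟨Matrix.of fun i => ψ (linearizedMap K a (g i)), ⟨⟨a, fun i => rfl⟩, ?_⟩, ?_⟩
    · intro i hi t ht
      rcases lt_or_ge (t : ℕ) μ with h | h
      · rw [Matrix.of_apply, key i hi t h, if_neg ht.not_gt]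
      · exact padVec_zero_of_le e _ t h
    · intro i hi t ht
      rw [Matrix.of_apply, key i hi t (ht.trans_le (hS i hi)), if_pos ht]

/-- A family spanning a complement of a proper subspace, together with a vector outside of it. -/
theorem linearIndependent_of_range_le_span {L κ : Type*} [Field L] [Algebra K L]
    [FiniteDimensional K L] [Fintype κ] (s : L →ₗ[K] L)
    (hs : Module.finrank K (LinearMap.ker s) ≤ 1) (hκ : Fintype.card κ = Module.finrank K L)
    (g : κ → L) (hg : LinearMap.range s ≤ Submodule.span K (Set.range g)) {k : κ}
    (hk : g k ∉ LinearMap.range s) : LinearIndependent K g := by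
  rw [linearIndependent_iff_card_le_finrank_span]
  -- The range of `s` has codimension at most one, so a strictly larger span is all of `L`.
  have h1 : LinearMap.range s < Submodule.span K (Set.range g) :=
    lt_of_le_of_ne hg fun h => hk (h ▸ Submodule.subset_span ⟨k, rfl⟩)
  have h2 := Submodule.finrank_lt_finrank_of_lt h1
  have h3 := LinearMap.finrank_range_add_finrank_ker s
  rw [Set.finrank]
  omega

/-- The bound on the kernel of `h ∘ s + b` for linearized polynomials `h` and `s`. -/
theorem finrank_ker_comp_add_smul_le {L : Type*} [Field L] [Algebra K L] [FiniteDimensional K L]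
    {k : ℕ} (a : Fin k → L) (c : Fin 2 → L) {γ : L} (hγ : γ ≠ 0)
    (hs : linearizedMap K c γ = 0) {b : K} (hb : b ≠ 0) :
    Module.finrank K (LinearMap.ker
      (linearizedMap K a ∘ₗ linearizedMap K c + b • LinearMap.id)) ≤ k := by
  set q := Fintype.card K
  have hq : 1 < q := Fintype.one_lt_card
  set p := (linearizedPoly q a).comp (linearizedPoly q c) +
    Polynomial.C (algebraMap K L b) * Polynomial.X with hp
  have heval : ∀ x, p.eval x =
      (linearizedMap K a ∘ₗ linearizedMap K c + b • LinearMap.id : L →ₗ[K] L) x := by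
    intro x
    simp [hp, Polynomial.eval_comp, eval_linearizedPoly, q, Algebra.smul_def]
  refine finrank_ker_le_of_eval _ (p := p) ?_ ?_ heval
  -- The composite kills `γ`, so the value there is `bγ ≠ 0`.
  · intro h0
    have := heval γ
    simp only [h0, Polynomial.eval_zero, LinearMap.add_apply, LinearMap.comp_apply, hs, map_zero,
      LinearMap.smul_apply, LinearMap.id_apply, zero_add] at this
    exact smul_ne_zero hb hγ this.symm
  · refine Polynomial.natDegree_add_le_of_degree_le ?_
      (((Polynomial.natDegree_C_mul_le _ _).trans Polynomial.natDegree_X_le).trans (Nat.one_le_pow _ _ (by omega)))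
    -- For `k = 0` the exponent `k - 1` would truncate; there the composite vanishes.
    rcases Nat.eq_zero_or_pos k with rfl | hk
    · simp [linearizedPoly]
    · refine Polynomial.natDegree_comp_le.trans ?_
      have h1 := natDegree_linearizedPoly_le hq (d := k - 1) (by omega) a
      have h2 := natDegree_linearizedPoly_le hq (d := 1) (by omega) c
      calc _ ≤ q ^ (k - 1) * q ^ 1 := Nat.mul_le_mul h1 h2
        _ = q ^ k := by rw [← pow_add]; congr 1; omega

/-- The systematic code with one more row than the degree of the field extension, where one of the
prescribed rows has a single entry and one of the other rows has an additional entry. -/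
theorem exists_systematicRowCode_of_one {μ w : ℕ} (S : Finset ι) (α : ι → ℕ) (hμ : 0 < μ)
    (hcard : Fintype.card ι = μ + 1) (hS : ∀ i ∈ S, α i ≤ μ) (hS' : ∀ i ∉ S, μ ≤ α i)
    {i₀ j₀ : ι} (hi₀ : i₀ ∈ S) (hα : α i₀ = 1) (hj₀ : j₀ ∉ S) (hαj : μ + 1 ≤ α j₀)
    (hw : μ + 1 ≤ w) :
    ∃ D : Submodule K (Matrix ι (Fin w) K), IsSystematicRowCode S α D := by
  obtain ⟨L, _, _, _, hL⟩ := exists_extension K μ hμ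
  have e : Module.Basis (Fin μ) K L := Module.finBasisOfFinrankEq K L hL
  have hij : i₀ ≠ j₀ := fun h => hj₀ (h ▸ hi₀)
  have hcard' : ∀ k : ι, Fintype.card {i // i ≠ k} = μ := by
    intro k
    have : Fintype.card {i // i ≠ k} = Fintype.card ι - 1 := by simp
    omega
  let z : Fin μ := ⟨0, hμ⟩
  obtain ⟨σ, hσ⟩ : ∃ σ : {i // i ≠ j₀} ≃ Fin μ, σ ⟨i₀, hij⟩ = z := by
    -- The swap makes `g i₀` the first basis vector, so that `bγ` has its only coordinate at
    -- position `0`.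
    let τ := Fintype.equivFinOfCardEq (hcard' j₀)
    exact ⟨τ.trans (Equiv.swap (τ ⟨i₀, hij⟩) z), by simp⟩
  set g : ι → L := fun i => if h : i ≠ j₀ then e (σ ⟨i, h⟩) else 0 with hg
  set γ : L := e z with hγ
  have hγ0 : γ ≠ 0 := e.ne_zero z
  have hg₀ : g i₀ = γ := by simp [hg, hij, hσ, hγ]
  set q := Fintype.card K with hq
  have hq1 : 1 < q := Fintype.one_lt_card
  -- The coefficients of `x ^ q - γ ^ (q - 1) * x`.
  set c : Fin 2 → L := ![-γ ^ (q - 1), 1] with hc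
  set s : L →ₗ[K] L := linearizedMap K c with hs
  have hsγ : s γ = 0 := by
    rw [hs, linearizedMap_apply, Fin.sum_univ_two]
    have : γ ^ (q - 1) * γ = γ ^ q := by rw [← pow_succ]; congr 1; omega
    simp [hc, ← hq, this]
  have hker : Module.finrank K (LinearMap.ker s) ≤ 1 := by
    have := finrank_ker_linearizedMap_lt (K := K) (a := c)
      (fun h => by simpa [hc] using congrFun h 1)
    rw [← hs] at this
    omega
  obtain ⟨θ, hθ⟩ : ∃ θ, θ ∉ LinearMap.range s := by
    by_contra! hall
    have htop : LinearMap.range s = ⊤ := Submodule.eq_top_iff'.2 hall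
    have hinj := (LinearMap.injective_iff_surjective (f := s)).2 (LinearMap.range_eq_top.1 htop)
    exact hγ0 (hinj (by rw [hsγ, map_zero]))
  set g' : {i // i ≠ i₀} → L := fun i => if i.1 = j₀ then θ else s (g i) with hg'
  have hg'i : LinearIndependent K g' := by
    refine linearIndependent_of_range_le_span s hker (by rw [hcard', hL]) g' ?_
      (k := ⟨j₀, hij.symm⟩) (by simpa [hg'] using hθ)
    rw [← Submodule.map_top, ← e.span_eq, Submodule.map_span, Submodule.span_le]
    rintro _ ⟨_, ⟨t, rfl⟩, rfl⟩
    obtain ⟨⟨i, hi⟩, rfl⟩ := σ.surjective t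
    by_cases hii : i = i₀
    · subst hii
      rw [hσ, hsγ]
      exact Submodule.zero_mem _
    · refine Submodule.subset_span ⟨⟨i, hii⟩, ?_⟩
      simp [hg', hg, hi]
  -- One coefficient fewer than `S.card`: the scalar `b` takes care of row `i₀`.
  let row : (Fin (S.card - 1) → L) → K → ι → Fin w → K := fun a b i =>
    if i = j₀ then padVec e w (linearizedMap K a θ, b)
    else padVec e w (linearizedMap K a (s (g i)) + b • g i, 0)
  have pad_zero : padVec e w ((0 : L), (0 : K)) = 0 := map_zero _
  have row_add : ∀ a a' b b' i, row (a + a') (b + b') i = row a b i + row a' b' i := by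
    intro a a' b b' i
    simp only [row]
    split_ifs
    · rw [← map_add, Prod.mk_add_mk, map_add, LinearMap.add_apply]
    · rw [← map_add, Prod.mk_add_mk, map_add, LinearMap.add_apply, add_smul, add_zero,
        add_add_add_comm]
  have row_smul : ∀ (r : K) a b i, row (algebraMap K L r • a) (r • b) i = r • row a b i := by
    intro r a b i
    simp only [row]
    split_ifs
    · rw [← map_smul, Prod.smul_mk, map_smul, LinearMap.smul_apply, algebraMap_smul]
    · rw [← map_smul, Prod.smul_mk, map_smul, LinearMap.smul_apply, algebraMap_smul, smul_add,
        smul_zero, smul_assoc]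
  let D : Submodule K (Matrix ι (Fin w) K) :=
    { carrier := {A | (∃ a b, ∀ i, A i = row a b i) ∧
        ∀ i ∈ S, ∀ t : Fin w, α i ≤ t → A i t = 0}
      zero_mem' := ⟨⟨0, 0, fun i => by
        by_cases h : i = j₀ <;> simp [row, h, pad_zero] <;> rfl⟩, fun _ _ _ _ => rfl⟩
      add_mem' := by
        rintro A B ⟨⟨a, b, ha⟩, hA⟩ ⟨⟨a', b', hb⟩, hB⟩
        refine ⟨⟨a + a', b + b', fun i => ?_⟩, fun i hi t ht => ?_⟩
        · rw [row_add, ← ha, ← hb]; rfl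
        · change A i t + B i t = 0
          rw [hA i hi t ht, hB i hi t ht, add_zero]
      smul_mem' := by
        rintro r A ⟨⟨a, b, ha⟩, hA⟩
        refine ⟨⟨algebraMap K L r • a, r • b, fun i => ?_⟩, fun i hi t ht => ?_⟩
        · rw [row_smul, ← ha]; rfl
        · change r • A i t = 0
          rw [hA i hi t ht, smul_zero] }
  have hSpos : 0 < S.card := Finset.card_pos.2 ⟨i₀, hi₀⟩
  refine ⟨D, ?_, ?_, ?_⟩
  · rintro A ⟨⟨a, b, ha⟩, hA⟩ i t ht
    by_cases hi : i ∈ S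
    · exact hA i hi t ht
    · rw [ha]
      by_cases hij : i = j₀
      · simp only [row, hij, if_true]
        refine padVec_of_gt e _ t ?_
        rw [hij] at ht
        omega
      · simp only [row, hij, if_false]
        exact padVec_zero_of_le e _ t ((hS' i hi).trans ht)
  · rintro A ⟨⟨a, b, ha⟩, -⟩ hA0
    -- Deleting row `i₀` leaves rank at least `μ - (S.card - 2)` when `b = 0`. Otherwise the rows
    -- other than `j₀` have rank at least `μ - (S.card - 1)`, and the entry `b` in column `μ` adds
    -- one.
    by_cases hb : b = 0
    · subst hb
      have ha0 : a ≠ 0 := by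
        rintro rfl
        apply hA0
        ext i t
        rw [ha]
        by_cases h : i = j₀ <;> simp [row, h, pad_zero]
      have h1 := finrank_ker_linearizedMap_lt (K := K) ha0
      have h2 := card_le_rank_add_finrank_ker hg'i
        ((padVec e w ∘ₗ LinearMap.inl K L K) ∘ₗ linearizedMap K a)
        (A.submatrix Subtype.val id) (by
          rintro ⟨i, hi⟩
          change A i = _
          rw [ha]
          by_cases h : i = j₀ <;> simp [row, h, hg'])
      rw [LinearMap.ker_comp_of_ker_eq_bot _ (ker_padVec_inl e (by omega)), hcard'] at h2
      have h3 := Matrix.rank_submatrix_le A (Subtype.val : {i // i ≠ i₀} → ι) id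
      omega
    · have h1 := finrank_ker_comp_add_smul_le a c hγ0 hsγ hb
      have h2 := card_le_rank_add_finrank_ker (ι := {i // i ≠ j₀}) (w := μ)
        (e.linearIndependent.comp _ σ.injective)
        (e.equivFun.toLinearMap ∘ₗ
          (linearizedMap K a ∘ₗ linearizedMap K c + b • LinearMap.id))
        (A.submatrix Subtype.val (Fin.castLE (by omega))) (by
          rintro ⟨i, hi⟩
          ext t
          change A i _ = _
          rw [ha]
          simp only [row, hi, if_false]
          rw [padVec_of_lt _ _ _ (by exact t.2)]
          simp [hg, hi, hs])
      rw [LinearMap.ker_comp_of_ker_eq_bot _ (LinearEquiv.ker _), hcard'] at h2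
      have h3 := rank_submatrix_lt_of_entry_ne_zero A (Subtype.val : {i // i ≠ j₀} → ι)
        (Fin.castLE (by omega : μ ≤ w)) j₀ ⟨μ, by omega⟩ (by
          rw [ha]
          simp only [row, if_true]
          rwa [padVec_of_eq _ _ (⟨μ, by omega⟩ : Fin w) rfl]) (by
          rintro ⟨i, hi⟩
          rw [ha]
          simp only [row, hi, if_false]
          exact padVec_zero_of_le e _ _ le_rfl)
      omega
  · intro x
    let S' := S.erase i₀
    let b : K := x i₀ 0
    -- The contribution `b • g i` is fixed by row `i₀`, so it is subtracted before interpolating at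
    -- `s (g i)`.
    let y : S' → L := fun i =>
      (e.equivFun.symm fun t => if (t : ℕ) < α i then x i t else 0) - b • g i
    have hS'ne : ∀ i : S', i.1 ≠ i₀ := fun i => Finset.ne_of_mem_erase i.2
    have hS'S : ∀ i : S', i.1 ∈ S := fun i => Finset.mem_of_mem_erase i.2
    obtain ⟨a, ha⟩ := exists_linearizedMap_interpolation (K := K) (ι := S') (k := S.card - 1)
      (by rw [Fintype.card_coe, Finset.card_erase_of_mem hi₀])
      (hg'i.comp (fun i : S' => (⟨i.1, hS'ne i⟩ : {i // i ≠ i₀}))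
        (fun i j h => Subtype.ext (congrArg (fun z => (z.1 : ι)) h))) y
    have key : ∀ (i) (_ : i ∈ S) (t : Fin w), (t : ℕ) < μ →
        row a b i t = if (t : ℕ) < α i then x i t else 0 := by
      intro i hi t ht
      have hne : i ≠ j₀ := fun h => hj₀ (h ▸ hi)
      simp only [row, hne, if_false]
      by_cases hii : i = i₀
      · subst hii
        rw [padVec_of_lt _ _ _ ht, hg₀, hsγ, map_zero, zero_add, map_smul, hγ, hα]
        by_cases h0 : (t : ℕ) = 0
        · simp [z, h0, b]
        · have : z ≠ ⟨(t : ℕ), ht⟩ := fun h => h0 (congrArg Fin.val h).symm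
          simp [this, h0]
      · have h1 := ha ⟨i, Finset.mem_erase.2 ⟨hii, hi⟩⟩
        simp only [Function.comp_apply, hg', hne, if_false, y] at h1
        rw [h1, sub_add_cancel]
        exact padVec_ofVec e (fun t => if t < α i then x i t else 0) t ht
    refine ⟨Matrix.of fun i => row a b i, ⟨⟨a, b, fun i => rfl⟩, ?_⟩, ?_⟩
    · intro i hi t ht
      rcases lt_or_ge (t : ℕ) μ with h | h
      · rw [Matrix.of_apply, key i hi t h, if_neg ht.not_gt]
      · have hne : i ≠ j₀ := fun h => hj₀ (h ▸ hi)
        simp only [Matrix.of_apply, row, hne, if_false]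
        exact padVec_zero_of_le e _ t h
    · intro i hi t ht
      rw [Matrix.of_apply, key i hi t (ht.trans_le (hS i hi)), if_pos ht]

end DiagonalCode

/-! ### Dot counts of Ferrers diagrams and the sorting condition. -/

section DotCounts

theorem mem_iff_lt_card_of_pred_closed (s : Finset ℕ) (h : ∀ i, i + 1 ∈ s → i ∈ s) (i : ℕ) :
    i ∈ s ↔ i < s.card := by
  have hdown : ∀ k i, i + k ∈ s → i ∈ s := by
    intro k
    induction k with
    | zero => intro i hi; exact hi
    | succ k ih => intro i hi; exact ih i (h _ hi)
  constructor
  · intro hi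
    have hsub : Finset.range (i + 1) ⊆ s := fun j hj => by
      have hj' := Finset.mem_range.1 hj
      exact hdown (i - j) j (by rwa [Nat.add_sub_cancel' (by omega)])
    simpa using Finset.card_le_card hsub
  · intro hi
    by_contra hni
    have hsub : s ⊆ Finset.range i := fun j hj => by
      by_contra hj'
      rw [Finset.mem_range, not_lt] at hj'
      exact hni (hdown (j - i) i (by rwa [Nat.add_sub_cancel' hj']))
    have := Finset.card_le_card hsub
    rw [Finset.card_range] at this
    omega

variable {m n : ℕ} {F : Finset (ℕ × ℕ)}

theorem IsFerrersDiagram.mem_iff_lt_colDots (hF : IsFerrersDiagram m n F) (i j : ℕ) :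
    (i, j) ∈ F ↔ i < colDots F j := by
  have hcard : colDots F j = ((F.filter fun p => p.2 = j).image Prod.fst).card := by
    rw [colDots, Finset.card_image_of_injOn]
    rintro ⟨a, b⟩ hp ⟨c, d⟩ hq h
    simp only [Finset.coe_filter, Set.mem_ofPred_eq] at hp hq
    exact Prod.ext h (hp.2.trans hq.2.symm)
  have hmem : ∀ i, i ∈ (F.filter fun p => p.2 = j).image Prod.fst ↔ (i, j) ∈ F := by
    intro i
    simp
  rw [hcard, ← mem_iff_lt_card_of_pred_closed, hmem]
  intro i hi
  rw [hmem] at hi ⊢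
  exact hF.up i j hi

theorem IsFerrersDiagram.mem_iff_lt_rowDots (hF : IsFerrersDiagram m n F) (i : ℕ) {t : ℕ}
    (ht : t < n) : (i, n - 1 - t) ∈ F ↔ t < rowDots F i := by
  have hcard : rowDots F i = ((F.filter fun p => p.1 = i).image fun p => n - 1 - p.2).card := by
    rw [rowDots, Finset.card_image_of_injOn]
    rintro ⟨a, b⟩ hp ⟨c, d⟩ hq h
    simp only [Finset.coe_filter, Set.mem_ofPred_eq] at hp hq h
    have h1 := (hF.subset _ _ hp.1).2
    have h2 := (hF.subset _ _ hq.1).2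
    exact Prod.ext (hp.2.trans hq.2.symm) (by change b = d; omega)
  have hmem : ∀ t, t ∈ (F.filter fun p => p.1 = i).image (fun p => n - 1 - p.2) ↔
      t < n ∧ (i, n - 1 - t) ∈ F := by
    intro t
    simp only [Finset.mem_image, Finset.mem_filter]
    constructor
    · rintro ⟨⟨a, b⟩, ⟨hab, rfl⟩, rfl⟩
      have h1 := (hF.subset _ _ hab).2
      refine ⟨by omega, ?_⟩
      have : n - 1 - (n - 1 - b) = b := by omega
      rwa [this]
    · rintro ⟨ht, h⟩
      exact ⟨_, ⟨h, rfl⟩, by dsimp only; omega⟩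
  rw [hcard, ← mem_iff_lt_card_of_pred_closed, hmem, and_iff_right ht]
  intro t ht
  rw [hmem] at ht ⊢
  refine ⟨by omega, ?_⟩
  have := hF.right i _ ht.2 (by omega)
  have h1 : n - 1 - (t + 1) + 1 = n - 1 - t := by omega
  rwa [h1] at this

theorem IsFerrersDiagram.rowDots_le (hF : IsFerrersDiagram m n F) (i : ℕ) : rowDots F i ≤ n := by
  by_contra! h
  have hsub : (F.filter fun p => p.1 = i) ⊆ {i} ×ˢ Finset.range n := by
    rintro ⟨a, b⟩ hp
    simp only [Finset.mem_filter] at hp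
    simp [hp.2, (hF.subset _ _ hp.1).2]
  have := Finset.card_le_card hsub
  rw [Finset.card_product, Finset.card_singleton, Finset.card_range, one_mul] at this
  exact absurd h this.not_gt

theorem IsFerrersDiagram.colDots_le (hF : IsFerrersDiagram m n F) (j : ℕ) : colDots F j ≤ m := by
  by_contra! h
  exact lt_irrefl m (hF.subset _ _ ((hF.mem_iff_lt_colDots m j).2 h)).1

theorem IsFerrersDiagram.rowDots_antitone (hF : IsFerrersDiagram m n F) :
    Antitone (rowDots F) := by
  refine antitone_nat_of_succ_le fun i => ?_
  by_contra! h
  have h1 := hF.rowDots_le (i + 1)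
  have h2 := (hF.mem_iff_lt_rowDots (i + 1) (t := rowDots F i) (by omega)).2 h
  exact lt_irrefl _ ((hF.mem_iff_lt_rowDots i (by omega)).1 (hF.up _ _ h2))

theorem IsFerrersDiagram.rowDots_zero (hF : IsFerrersDiagram m n F) : rowDots F 0 = n := by
  refine le_antisymm (hF.rowDots_le 0) ?_
  have hn := hF.cols_pos
  have := (hF.mem_iff_lt_rowDots 0 (t := n - 1) (by omega)).1 (hF.first_row _ (by omega))
  omega

theorem IsFerrersDiagram.rowDots_pos (hF : IsFerrersDiagram m n F) {i : ℕ} (hi : i < m) :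
    0 < rowDots F i :=
  (hF.mem_iff_lt_rowDots i hF.cols_pos).1 (hF.last_col i hi)

theorem countP_lt_le_of_le_getD_sort (s : Multiset ℕ) {p v : ℕ}
    (h : v ≤ (s.sort (· ≤ ·)).getD p 0) : s.countP (· < v) ≤ p := by
  set l := s.sort (· ≤ ·) with hl
  have hsl : s.countP (· < v) = l.countP (· < v) := by
    rw [← Multiset.coe_countP, hl, Multiset.sort_eq]
  have hsorted : l.Pairwise (· ≤ ·) := Multiset.pairwise_sort s _
  rw [hsl, ← List.take_append_drop p l, List.countP_append]
  have h1 : (l.take p).countP (· < v) ≤ p :=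
    List.countP_le_length.trans (List.length_take_le _ _)
  have h2 : (l.drop p).countP (· < v) = 0 := by
    rw [List.countP_eq_zero]
    intro a ha
    obtain ⟨k, hk, rfl⟩ := List.mem_iff_getElem.1 ha
    rw [List.length_drop] at hk
    have hp : p < l.length := by omega
    rw [List.getD_eq_getElem _ _ hp] at h
    rw [List.getElem_drop]
    have : l[p] ≤ l[p + k] := by
      rcases Nat.eq_zero_or_pos k with rfl | hk0
      · simp
      · exact List.pairwise_iff_getElem.1 hsorted p (p + k) hp (by omega) (by omega)
    simp only [decide_eq_true_eq, not_lt]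
    omega
  omega

/-- Otherwise the entry `1`, the rows of `F₁` from `δ - 2` on and all columns of `F₃` lie below `v`.
These are `m₁ + n₃ - δ + 3` entries, one more than the sorted position allows. -/
theorem le_rowDots_of_le_sortedDot {m₁ n₁ m₃ n₃ δ : ℕ} {F₁ F₃ : Finset (ℕ × ℕ)}
    (hF₁ : IsFerrersDiagram m₁ n₁ F₁) (hF₃ : IsFerrersDiagram m₃ n₃ F₃)
    (hδ : 2 ≤ δ) (hδm : δ ≤ m₁ + 1) (h4 : m₃ ≤ rowDots F₁ (δ - 2)) {v : ℕ}
    (h3 : v ≤ sortedDot m₁ n₃ F₁ F₃ (m₁ + n₃ - δ + 2)) : v ≤ rowDots F₁ (δ - 2) := by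
  by_contra! hlt
  have h := countP_lt_le_of_le_getD_sort _ h3
  rw [Multiset.countP_add, Multiset.countP_add] at h
  have hpos := hF₁.rowDots_pos (i := δ - 2) (by omega)
  have h1 : ({1} : Multiset ℕ).countP (· < v) = 1 := by
    rw [show ({1} : Multiset ℕ) = 1 ::ₘ 0 from rfl, Multiset.countP_cons_of_pos _ (by omega)]
    simp
  have h2 : m₁ - (δ - 2) ≤ ((Multiset.range m₁).map (rowDots F₁)).countP (· < v) := by
    rw [Multiset.countP_map]
    have hsub : Finset.Ico (δ - 2) m₁ ⊆ (Finset.range m₁).filter fun i => rowDots F₁ i < v := by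
      intro i hi
      rw [Finset.mem_Ico] at hi
      exact Finset.mem_filter.2 ⟨Finset.mem_range.2 hi.2,
        (hF₁.rowDots_antitone hi.1).trans_lt hlt⟩
    have := Finset.card_le_card hsub
    rw [Nat.card_Ico] at this
    exact this
  have h5 : n₃ ≤ ((Multiset.range n₃).map (colDots F₃)).countP (· < v) := by
    rw [Multiset.countP_map, Multiset.filter_eq_self.2, Multiset.card_range]
    intro j _
    exact ((hF₃.colDots_le j).trans h4).trans_lt hlt
  have hn := hF₃.cols_pos
  omega

end DotCounts

/-! ### Membership in the composite diagram, block by block. -/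

section Array

variable {m₁ n₁ m₃ n₃ : ℕ} {F₁ F₃ : Finset (ℕ × ℕ)}

theorem mem_oneDotArray (i j : ℕ) : (i, j) ∈ oneDotArray m₁ n₁ n₃ F₁ F₃ ↔
    (i, j) ∈ F₁ ∨ (i = m₁ ∧ j = n₁ - 1) ∨ (m₁ ≤ i ∧ n₁ ≤ j ∧ (i - m₁, j - n₁) ∈ F₃) ∨
      (i < m₁ ∧ n₁ ≤ j ∧ j < n₁ + n₃) := by
  simp only [oneDotArray, shiftDiagram, fullDiagram, Finset.mem_union, Finset.mem_singleton,
    Finset.mem_image, Finset.mem_product, Finset.mem_range, Prod.mk.injEq, Prod.exists, or_assoc]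
  refine or_congr Iff.rfl (or_congr Iff.rfl (or_congr ?_ ?_))
  · constructor
    · rintro ⟨a, b, hab, rfl, rfl⟩
      simpa using hab
    · rintro ⟨hi, hj, h⟩
      exact ⟨_, _, h, by omega, by omega⟩
  · constructor
    · rintro ⟨a, b, hab, rfl, rfl⟩
      omega
    · rintro ⟨hi, hj, h⟩
      exact ⟨i, j - n₁, by omega, by omega, by omega⟩

theorem mem_oneDotArray_upper_left {i j : ℕ} (hi : i < m₁) (hj : j < n₁) :
    (i, j) ∈ oneDotArray m₁ n₁ n₃ F₁ F₃ ↔ (i, j) ∈ F₁ := by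
  rw [mem_oneDotArray]
  constructor
  · rintro (h | h | h | h)
    · exact h
    all_goals omega
  · exact Or.inl

theorem mem_oneDotArray_upper_right {i j : ℕ} (hi : i < m₁) (hj : j < n₃) :
    (i, n₁ + j) ∈ oneDotArray m₁ n₁ n₃ F₁ F₃ := by
  rw [mem_oneDotArray]
  omega

theorem mem_oneDotArray_lower_left (hF₁ : IsFerrersDiagram m₁ n₁ F₁) {i j : ℕ} (hj : j < n₁) :
    (m₁ + i, j) ∈ oneDotArray m₁ n₁ n₃ F₁ F₃ ↔ i = 0 ∧ j + 1 = n₁ := by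
  rw [mem_oneDotArray]
  constructor
  · rintro (h | h | h | h)
    · have := hF₁.subset _ _ h
      omega
    all_goals omega
  · intro h
    exact Or.inr (Or.inl (by omega))

theorem mem_oneDotArray_lower_right (hF₁ : IsFerrersDiagram m₁ n₁ F₁) {i j : ℕ} :
    (m₁ + i, n₁ + j) ∈ oneDotArray m₁ n₁ n₃ F₁ F₃ ↔ (i, j) ∈ F₃ := by
  have hn := hF₁.cols_pos
  rw [mem_oneDotArray]
  constructor
  · rintro (h | h | ⟨_, _, h⟩ | h)
    · have := hF₁.subset _ _ h
      omega
    · omega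
    · simpa using h
    · omega
  · intro h
    exact Or.inr (Or.inr (Or.inl ⟨by omega, by omega, by simpa using h⟩))

theorem rowDots_oneDotArray_le {i : ℕ} (hi : i < m₁) :
    rowDots (oneDotArray m₁ n₁ n₃ F₁ F₃) i ≤ rowDots F₁ i + n₃ := by
  have hsub : (oneDotArray m₁ n₁ n₃ F₁ F₃).filter (fun p => p.1 = i) ⊆
      F₁.filter (fun p => p.1 = i) ∪ (Finset.range n₃).image fun j => (i, n₁ + j) := by
    rintro ⟨a, b⟩ hab
    obtain ⟨hp, rfl⟩ : (a, b) ∈ oneDotArray m₁ n₁ n₃ F₁ F₃ ∧ a = i := by simpa using hab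
    rw [mem_oneDotArray] at hp
    rw [Finset.mem_union, Finset.mem_filter, Finset.mem_image]
    rcases hp with h | h | h | h
    · exact Or.inl ⟨h, rfl⟩
    · omega
    · omega
    · exact Or.inr ⟨b - n₁, Finset.mem_range.2 (by omega), Prod.ext rfl (by dsimp only; omega)⟩
  refine (Finset.card_le_card hsub).trans ((Finset.card_union_le _ _).trans ?_)
  exact Nat.add_le_add le_rfl (Finset.card_image_le.trans (Finset.card_range _).le)

end Array

/-! ### Folding the row matrix into the array without losing rank. -/

section Assembly

variable {K : Type*} [Field K] {m₁ n₁ m₃ n₃ : ℕ}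

/-- The rows of the matrix `p.1` become the (reversed) rows of the upper left block, the columns of
the lower right block and the single entry of the lower left block; `p.2` is the upper right
block. -/
def assemble (h : m₃ ≤ n₁) :
    Matrix ((Fin m₁ ⊕ Fin n₃) ⊕ Unit) (Fin n₁) K × Matrix (Fin m₁) (Fin n₃) K →ₗ[K]
      Matrix (Fin m₁ ⊕ Fin m₃) (Fin n₁ ⊕ Fin n₃) K where
  toFun p := Matrix.fromBlocks (Matrix.of fun i j => p.1 (Sum.inl (Sum.inl i)) j.rev) p.2
    (Matrix.of fun i j => if (i : ℕ) = 0 ∧ (j : ℕ) + 1 = n₁ then p.1 (Sum.inr ()) j.rev else 0)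
    (Matrix.of fun i j => p.1 (Sum.inl (Sum.inr j)) (Fin.castLE h i))
  map_add' p p' := by
    ext (i | i) (j | j) <;> simp
    split_ifs <;> simp
  map_smul' r p := by
    ext (i | i) (j | j) <;> simp

theorem rank_le_one_add_rank_submatrix_succ {a : Type*} [Fintype a] {k : ℕ}
    (N : Matrix a (Fin (k + 1)) K) : N.rank ≤ 1 + (N.submatrix id Fin.succ).rank := by
  classical
  have hN : N = Matrix.of (fun i t => if t = 0 then N i t else 0) +
      Matrix.of (fun i t => if t = 0 then 0 else N i t) := by
    ext i t
    by_cases ht : t = 0 <;> simp [ht]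
  conv_lhs => rw [hN]
  refine (rank_add_le_rank_add _ _).trans (Nat.add_le_add ?_ ?_)
  · have := rank_le_card_rows_add_card_cols
      (Matrix.of (fun i t => if t = 0 then N i t else 0)) ∅ {0} (by
        intro i t _ ht
        rw [Matrix.of_apply, if_neg (by simpa using ht)])
    rwa [Finset.card_empty, Finset.card_singleton, zero_add] at this
  · refine (rank_le_rank_submatrix_of_support _ Fin.succ ?_).trans (le_of_eq ?_)
    · intro i t ht
      rw [Fin.range_succ] at ht
      rw [Matrix.of_apply, if_pos (by simpa using ht)]
    · rfl

/-- If the dot entry is zero, the array is block triangular with diagonal blocks from the two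
families of rows. If not, removing column `0` of `N` costs at most one rank. In the array the dot
then becomes a middle 1×1 diagonal block, which restores it. -/
theorem rank_le_rank_assemble (h : m₃ ≤ n₁) (hn : 0 < n₁) (hm : 0 < m₃)
    (N : Matrix ((Fin m₁ ⊕ Fin n₃) ⊕ Unit) (Fin n₁) K) (A : Matrix (Fin m₁) (Fin n₃) K)
    (hdot : ∀ t : Fin n₁, 1 ≤ (t : ℕ) → N (Sum.inr ()) t = 0)
    (hcol : ∀ j, ∀ t : Fin n₁, m₃ ≤ (t : ℕ) → N (Sum.inl (Sum.inr j)) t = 0) :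
    N.rank ≤ (assemble h (N, A)).rank := by
  obtain ⟨n, rfl⟩ : ∃ n, n₁ = n + 1 := ⟨n₁ - 1, by omega⟩
  obtain ⟨m, rfl⟩ : ∃ m, m₃ = m + 1 := ⟨m₃ - 1, by omega⟩
  by_cases ha : N (Sum.inr ()) 0 = 0
  · set T : Matrix (Fin m₁) (Fin (n + 1)) K := Matrix.of fun i t => N (Sum.inl (Sum.inl i)) t
      with hT
    set U : Matrix (Fin n₃) (Fin (n + 1)) K := Matrix.of fun j t => N (Sum.inl (Sum.inr j)) t
      with hU
    have hN : N = Matrix.fromRows (Matrix.fromRows T U) 0 := by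
      ext ((i | i) | i) t
      · rfl
      · rfl
      · rcases Fin.eq_zero_or_eq_succ t with rfl | ⟨t, rfl⟩
        · exact ha
        · exact hdot _ (by simp)
    have hM : assemble h (N, A) = Matrix.fromBlocks (T.submatrix id Fin.rev) A 0
        (U.submatrix id (Fin.castLE h)).transpose := by
      ext (i | i) (j | j)
      · rfl
      · rfl
      · simp only [assemble, LinearMap.coe_mk, AddHom.coe_mk, Matrix.fromBlocks_apply₂₁,
          Matrix.of_apply, Matrix.zero_apply, ite_eq_right_iff]
        rintro ⟨_, hj⟩
        have : j.rev = 0 := by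
          apply Fin.ext
          simp [Fin.val_rev]
          omega
        rw [this, ha]
      · rfl
    have h1 := rank_fromBlocks_zero_ge (T.submatrix id Fin.rev) A
      (U.submatrix id (Fin.castLE h)).transpose
    have h2 : T.rank ≤ (T.submatrix id Fin.rev).rank := by
      have := Matrix.rank_submatrix_le (T.submatrix id Fin.rev) id Fin.rev
      rw [Matrix.submatrix_submatrix] at this
      have hrev : (Fin.rev ∘ Fin.rev : Fin (n + 1) → Fin (n + 1)) = id := funext Fin.rev_rev
      rwa [hrev] at this
    have h3 : U.rank ≤ (U.submatrix id (Fin.castLE h)).rank := by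
      refine rank_le_rank_submatrix_of_support U _ fun j t ht => ?_
      refine hcol j t ?_
      by_contra! hlt
      exact ht ⟨⟨t, hlt⟩, rfl⟩
    rw [hM]
    rw [Matrix.rank_transpose] at h1
    have h4 := (rank_fromRows_zero (c := Unit) (Matrix.fromRows T U)).trans (rank_fromRows_le T U)
    rw [← hN] at h4
    omega
  · set T : Matrix (Fin m₁) (Fin n) K := Matrix.of fun i t => N (Sum.inl (Sum.inl i)) t.succ
      with hT
    set U : Matrix (Fin n₃) (Fin n) K := Matrix.of fun j t => N (Sum.inl (Sum.inr j)) t.succ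
      with hU
    have hN : N.submatrix id Fin.succ = Matrix.fromRows (Matrix.fromRows T U) 0 := by
      ext ((i | i) | i) t
      · rfl
      · rfl
      · exact hdot _ (by simp)
    have h' : m ≤ n := by omega
    -- Row and column of the dot are put in the middle; both correspond to position `0` of `N`, the
    -- columns of the left blocks being reversed.
    let r : Fin m₁ ⊕ (Unit ⊕ Fin m) → Fin m₁ ⊕ Fin (m + 1) :=
      Sum.elim Sum.inl (Sum.elim (fun _ => Sum.inr 0) fun i => Sum.inr i.succ)
    let c : Fin n ⊕ (Unit ⊕ Fin n₃) → Fin (n + 1) ⊕ Fin n₃ :=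
      Sum.elim (fun t => Sum.inl t.succ.rev) (Sum.elim (fun _ => Sum.inl (Fin.rev 0)) Sum.inr)
    set M := assemble h (N, A) with hMdef
    let a : Matrix Unit Unit K := Matrix.of fun _ _ => N (Sum.inr ()) 0
    have hM : M.submatrix r c = Matrix.fromBlocks T
        (M.submatrix Sum.inl (Sum.elim (fun _ => Sum.inl (Fin.rev 0)) Sum.inr)) 0
        (Matrix.fromBlocks a (M.submatrix (fun _ => Sum.inr 0) Sum.inr) 0
          (U.submatrix id (Fin.castLE h')).transpose) := by
      ext (i | i | i) (j | j | j)
      · simp [M, assemble, r, c, T]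
      · rfl
      · rfl
      · simp [M, assemble, r, c]
        omega
      · simp [M, assemble, r, c, a]
      · rfl
      · simp [M, assemble, r, c]
      · simp [M, assemble, r, c]
      · rfl
    have h1 := (rank_fromBlocks_zero_ge _ _ _).trans (hM ▸ Matrix.rank_submatrix_le M r c)
    have h2 := rank_fromBlocks_zero_ge a (M.submatrix (fun _ => Sum.inr 0) Sum.inr)
      (U.submatrix id (Fin.castLE h')).transpose
    have h3 : U.rank ≤ (U.submatrix id (Fin.castLE h')).rank := by
      refine rank_le_rank_submatrix_of_support U _ fun j t ht => ?_
      refine hcol j t.succ ?_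
      by_contra! hlt
      rw [Fin.val_succ] at hlt
      exact ht ⟨⟨t, by omega⟩, rfl⟩
    have h4 := (rank_fromRows_zero (c := Unit) (Matrix.fromRows T U)).trans (rank_fromRows_le T U)
    rw [← hN] at h4
    have h5 := rank_le_one_add_rank_submatrix_succ N
    have h6 : a.rank = Fintype.card Unit := Matrix.rank_of_det_ne_zero (by simpa [a] using ha)
    rw [Fintype.card_unit] at h6
    rw [Matrix.rank_transpose] at h2
    omega

theorem rank_le_rank_assemble_zero (h : m₃ ≤ n₁) (A : Matrix (Fin m₁) (Fin n₃) K) :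
    A.rank ≤ (assemble h (0, A)).rank :=
  Matrix.rank_submatrix_le (assemble h (0, A)) Sum.inl Sum.inr

end Assembly

/-! ### The two component codes and the final construction. -/

/-- The code on the upper right block. -/
theorem exists_systematicRowCode_upper_right {K : Type*} [Field K] [Fintype K] {m n δ : ℕ}
    (hn : 0 < n) (hδm : δ ≤ m + 1) (h : δ < m + 1 → m ≤ n) :
    ∃ D : Submodule K (Matrix (Fin m) (Fin n) K),
      IsSystematicRowCode (Finset.univ.filter fun i : Fin m => δ - 1 ≤ (i : ℕ)) (fun _ => n) D := by
  rcases hδm.lt_or_eq with hlt | rfl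
  · exact exists_systematicRowCode _ _ hn (by simpa using h hlt) (fun _ _ => le_rfl)
      (fun _ _ => le_rfl) le_rfl
  -- Here `δ - 1 = m`, so no row has to be prescribed and the zero code suffices.
  · refine ⟨⊥, ?_, ?_, ?_⟩
    · intro A hA i t _
      rw [(Submodule.mem_bot K).1 hA]; rfl
    · intro A hA h0
      exact absurd ((Submodule.mem_bot K).1 hA) h0
    · refine fun x => ⟨0, Submodule.zero_mem _, fun i hi => ?_⟩
      have := (Finset.mem_filter.1 hi).2
      omega

/-- The code whose rows hold the entries outside the upper right block. -/
theorem exists_diagonal_code {K : Type*} [Field K] [Fintype K] {m₁ n₁ m₃ n₃ δ : ℕ}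
    {F₁ F₃ : Finset (ℕ × ℕ)} (hF₁ : IsFerrersDiagram m₁ n₁ F₁) (hF₃ : IsFerrersDiagram m₃ n₃ F₃)
    (hδ : 2 ≤ δ) (hδm : δ ≤ m₁ + 1) (hn : 1 + m₁ + n₃ ≤ n₁)
    (h3 : m₁ + n₃ ≤ rowDots F₁ (δ - 2)) (h4 : m₃ ≤ rowDots F₁ (δ - 2)) :
    ∃ (S : Finset ((Fin m₁ ⊕ Fin n₃) ⊕ Unit))
      (D : Submodule K (Matrix ((Fin m₁ ⊕ Fin n₃) ⊕ Unit) (Fin n₁) K)),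
      S.card + (δ - 1) = m₁ + n₃ + 1 ∧
      (∀ i, Sum.inl (Sum.inl i) ∈ S ↔ δ - 1 ≤ (i : ℕ)) ∧
      (∀ j, Sum.inl (Sum.inr j) ∈ S) ∧ Sum.inr () ∈ S ∧
      IsSystematicRowCode S (Sum.elim (Sum.elim (fun i => rowDots F₁ i) fun j => colDots F₃ j)
        fun _ => 1) D := by
  classical
  let φ : Fin (δ - 1) → (Fin m₁ ⊕ Fin n₃) ⊕ Unit :=
    fun i => Sum.inl (Sum.inl (Fin.castLE (by omega) i))
  have hφ : Function.Injective φ := by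
    intro i j hij
    simpa [φ] using hij
  set S : Finset ((Fin m₁ ⊕ Fin n₃) ⊕ Unit) := (Finset.univ.image φ)ᶜ with hS
  have hcard : Fintype.card ((Fin m₁ ⊕ Fin n₃) ⊕ Unit) = m₁ + n₃ + 1 := by simp
  have hScard : S.card + (δ - 1) = m₁ + n₃ + 1 := by
    rw [hS, Finset.card_compl, Finset.card_image_of_injective _ hφ, hcard, Finset.card_univ,
      Fintype.card_fin]
    omega
  have hS1 : ∀ i, Sum.inl (Sum.inl i) ∈ S ↔ δ - 1 ≤ (i : ℕ) := by
    intro i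
    simp only [hS, Finset.mem_compl, Finset.mem_image, Finset.mem_univ, true_and, φ,
      Sum.inl.injEq, not_exists]
    constructor
    · intro h
      by_contra! hlt
      exact h ⟨i, hlt⟩ rfl
    · rintro h j rfl
      have := j.2
      simp only [Fin.val_castLE] at h
      omega
  have hS2 : ∀ j, Sum.inl (Sum.inr j) ∈ S := by
    intro j
    simp [hS, φ]
  have hS3 : Sum.inr () ∈ S := by simp [hS, φ]
  set α : (Fin m₁ ⊕ Fin n₃) ⊕ Unit → ℕ :=
    Sum.elim (Sum.elim (fun i => rowDots F₁ i) fun j => colDots F₃ j) fun _ => 1 with hα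
  set μ := rowDots F₁ (δ - 2) with hμ
  have hμ0 : 0 < μ := hF₁.rowDots_pos (by omega)
  have hle : ∀ i ∈ S, α i ≤ μ := by
    rintro ((i | j) | i) hi
    · have := (hS1 i).1 hi
      exact hF₁.rowDots_antitone (by omega)
    · exact (hF₃.colDots_le j).trans h4
    · exact hμ0
  have hge : ∀ i ∉ S, μ ≤ α i := by
    rintro ((i | j) | i) hi
    · rw [hS1] at hi
      exact hF₁.rowDots_antitone (by omega)
    · exact absurd (hS2 j) hi
    · exact absurd hS3 hi
  have hμn : μ ≤ n₁ := hF₁.rowDots_le _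
  obtain ⟨D, hD⟩ : ∃ D : Submodule K (Matrix ((Fin m₁ ⊕ Fin n₃) ⊕ Unit) (Fin n₁) K),
      IsSystematicRowCode S α D := by
    -- In the equality case row `0` of `F₁` is free since `δ ≥ 2`, and its `n₁ ≥ μ + 1` dots leave
    -- room for the extra entry.
    rcases h3.lt_or_eq with hlt | heq
    · exact exists_systematicRowCode S α hμ0 (by omega) hle hge hμn
    · refine exists_systematicRowCode_of_one S α hμ0 (by omega) hle hge hS3 rfl
        (j₀ := Sum.inl (Sum.inl ⟨0, hF₁.rows_pos⟩)) (by rw [hS1]; simp; omega) ?_ (by omega)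
      change μ + 1 ≤ rowDots F₁ 0
      rw [hF₁.rowDots_zero]
      omega
  exact ⟨S, D, hScard, hS1, hS2, hS3, hD⟩

theorem theorem4p11 (m₁ n₁ m₃ n₃ δ : ℕ) (F F₁ F₃ : Finset (ℕ × ℕ))
    (hF₁ : IsFerrersDiagram m₁ n₁ F₁)
    (hF₃ : IsFerrersDiagram m₃ n₃ F₃)
    (hF : IsFerrersDiagram (m₁ + m₃) (n₁ + n₃) F)
    (hshape : F = oneDotArray m₁ n₁ n₃ F₁ F₃)
    (hδ : 2 ≤ δ) (hδm : δ ≤ m₁ + 1)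
    (h1 : δ < m₁ + 1 → m₁ ≤ n₃)
    (h2 : 1 + m₁ + n₃ ≤ max n₁ m₃)
    (h3 : m₁ + n₃ ≤ sortedDot m₁ n₃ F₁ F₃ (m₁ + n₃ - δ + 2))
    (h4 : (m₃ : ℤ) ≤ (rowDots F (δ - 2) : ℤ) - (n₃ : ℤ))
    (q : ℕ) (hq : IsPrimePow q)
    (K : Type*) [Field K] [Finite K] (hK : Nat.card K = q) :
    ∃ C : Submodule K (Matrix (Fin (m₁ + m₃)) (Fin (n₁ + n₃)) K),
      IsOptimalFDRMCode F C (∑ i ∈ Finset.Ico (δ - 1) (m₁ + m₃), rowDots F i) δ := by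
  classical
  have := Fintype.ofFinite K
  have hrow := rowDots_oneDotArray_le (m₁ := m₁) (n₁ := n₁) (n₃ := n₃) (F₁ := F₁) (F₃ := F₃)
    (i := δ - 2) (by omega)
  rw [← hshape] at hrow
  -- This also yields `m₃ ≤ n₁`, so the maximum in the size condition is `n₁`.
  have hm₃ : m₃ ≤ rowDots F₁ (δ - 2) := by omega
  have hv := le_rowDots_of_le_sortedDot hF₁ hF₃ hδ hδm hm₃ h3
  have hmn : m₃ ≤ n₁ := hm₃.trans (hF₁.rowDots_le _)
  rw [max_eq_left hmn] at h2
  obtain ⟨S, D, hScard, hS1, hS2, hS3, hD⟩ :=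
    exists_diagonal_code (K := K) hF₁ hF₃ hδ hδm h2 hv hm₃
  obtain ⟨E, hE⟩ := exists_systematicRowCode_upper_right (K := K) hF₃.cols_pos hδm h1
  let R := Matrix.reindexLinearEquiv K K (finSumFinEquiv (m := m₁) (n := m₃))
    (finSumFinEquiv (m := n₁) (n := n₃))
  let Φ := R.toLinearMap ∘ₗ assemble (K := K) (m₁ := m₁) (n₃ := n₃) hmn
  have hΦ : ∀ p i j, Φ p (finSumFinEquiv i) (finSumFinEquiv j) = assemble hmn p i j := by
    intro p i j
    simp [Φ, R]
  have hrankΦ : ∀ p, (Φ p).rank = (assemble hmn p).rank :=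
    fun p => Matrix.rank_reindex _ _ _
  refine ⟨(D.prod E).map Φ, isOptimalFDRMCode_of_systematic hF _ ?_ (by omega) (by
    have := hF₃.rows_pos; omega) ?_ ?_⟩
  · rintro _ ⟨⟨N, A⟩, ⟨hN, hA⟩, rfl⟩ i j hij
    obtain ⟨i, rfl⟩ := finSumFinEquiv.surjective i
    obtain ⟨j, rfl⟩ := finSumFinEquiv.surjective j
    rw [hΦ]
    rw [hshape] at hij
    rcases i with i | i <;> rcases j with j | j
    · refine hD.support N hN _ _ ?_
      by_contra! hlt
      have hlt' := (hF₁.mem_iff_lt_rowDots i (t := j.rev) (j.rev).2).2 hlt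
      rw [Fin.val_rev] at hlt'
      apply hij
      simp only [finSumFinEquiv_apply_left, Fin.val_castAdd]
      rw [mem_oneDotArray_upper_left i.2 j.2]
      convert hlt' using 2
      omega
    · exact absurd (by simpa using mem_oneDotArray_upper_right i.2 j.2) hij
    · simp only [finSumFinEquiv_apply_left, finSumFinEquiv_apply_right, Fin.val_castAdd,
        Fin.val_natAdd] at hij
      rw [mem_oneDotArray_lower_left hF₁ j.2] at hij
      exact if_neg hij
    · refine hD.support N hN _ _ ?_
      by_contra! hlt
      apply hij
      simp only [finSumFinEquiv_apply_right, Fin.val_natAdd]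
      rw [mem_oneDotArray_lower_right hF₁]
      exact (hF₃.mem_iff_lt_colDots i j).2 hlt
  · rintro _ ⟨⟨N, A⟩, ⟨hN, hA⟩, rfl⟩ h0
    rw [hrankΦ]
    by_cases hN0 : N = 0
    · subst hN0
      have hA0 : A ≠ 0 := by
        rintro rfl
        exact h0 (map_zero Φ)
      have hr := hE.rank A hA hA0
      have hc : (Finset.univ.filter fun i : Fin m₁ => δ - 1 ≤ (i : ℕ)).card ≤ m₁ - (δ - 1) := by
        have := Finset.card_le_card_of_injOn
          (s := Finset.univ.filter fun i : Fin m₁ => δ - 1 ≤ (i : ℕ))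
          (t := Finset.Ico (δ - 1) m₁) (fun i => (i : ℕ))
          (by
            intro i hi
            have := (Finset.mem_filter.1 hi).2
            exact Finset.mem_coe.2 (Finset.mem_Ico.2 ⟨this, i.2⟩))
          (by intro x _ y _ h; exact Fin.ext h)
        rwa [Nat.card_Ico] at this
      rw [Fintype.card_fin] at hr
      have := rank_le_rank_assemble_zero hmn A
      omega
    · have hr := hD.rank N hN hN0
      have hle := rank_le_rank_assemble hmn hF₁.cols_pos hF₃.rows_pos N A
        (fun t ht => hD.support N hN _ t ht)
        (fun j t ht => hD.support N hN _ t ((hF₃.colDots_le j).trans ht))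
      have hcard : Fintype.card ((Fin m₁ ⊕ Fin n₃) ⊕ Unit) = m₁ + n₃ + 1 := by simp
      omega
  · intro z
    -- Rows of `F₁` are stored from right to left, hence the column `n₁ - 1 - t`.
    obtain ⟨N, hN, hNz⟩ := hD.systematic
      (Sum.elim (Sum.elim (fun i t => z i (n₁ - 1 - t)) fun j t => z (m₁ + t) (n₁ + j))
        fun _ _ => z m₁ (n₁ - 1))
    obtain ⟨A, hA, hAz⟩ := hE.systematic fun i t => z i (n₁ + t)
    refine ⟨Φ (N, A), ⟨(N, A), ⟨hN, hA⟩, rfl⟩, ?_⟩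
    intro i j hi hij
    obtain ⟨i, rfl⟩ := finSumFinEquiv.surjective i
    obtain ⟨j, rfl⟩ := finSumFinEquiv.surjective j
    rw [hΦ]
    rw [hshape] at hij
    rcases i with i | i <;> rcases j with j | j <;>
      simp only [finSumFinEquiv_apply_left, finSumFinEquiv_apply_right, Fin.val_castAdd,
        Fin.val_natAdd] at hi hij ⊢
    · have hj : n₁ - 1 - (j.rev : ℕ) = j := by rw [Fin.val_rev]; omega
      rw [mem_oneDotArray_upper_left i.2 j.2, ← hj, hF₁.mem_iff_lt_rowDots i j.rev.2] at hij
      refine (hNz (Sum.inl (Sum.inl i)) ((hS1 i).2 hi) j.rev hij).trans ?_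
      simp only [Sum.elim_inl, hj]
    · exact hAz i (by simpa using hi) j j.2
    · rw [mem_oneDotArray_lower_left hF₁ j.2] at hij
      have hrev : (j.rev : ℕ) < 1 := by rw [Fin.val_rev]; omega
      refine (if_pos hij).trans ((hNz (Sum.inr ()) hS3 j.rev hrev).trans ?_)
      have h5 : n₁ - 1 = (j : ℕ) := by omega
      simp only [Sum.elim_inr, hij.1, h5, add_zero]
    · rw [mem_oneDotArray_lower_right hF₁, hF₃.mem_iff_lt_colDots] at hij
      exact hNz (Sum.inl (Sum.inr j)) (hS2 j) (Fin.castLE hmn i) hij
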